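/- Notation. For a real matrix $M$ let $\|M\|_2$ be its spectral norm, $\|M\|_\infty=\max_i\sum_j|M_{ij}|$, and $\|M\|_{2\to\infty}=\max_i\big(\sum_j M_{ij}^2\big)^{1/2}$. Let $\mathbb{O}_{n,k}$ be the set of $U\in\mathbb{R}^{n\times k}$ with $U^{\mathsf T}U=I_k$. For $V,W\in\mathbb{O}_{n,r}$ put $\mathrm{dist}_{2\to\infty}(V,W)=\inf_{O\in\mathbb{O}_{r,r}}\|V-WO\|_{2\to\infty}$. For $B\in\mathbb{R}^{r\times r}$, $C\in\mathbb{R}^{n\times n}$, $W\in\mathbb{R}^{n\times k}$ put $$\mathsf{sep}_{2\to\infty,W}(B,C)=\inf\{\|ZB-CZ\|_{2\to\infty} : Z=WY \text{ for some } Y\in\mathbb{R}^{k\times r},\ \|Z\|_{2\to\infty}=1\}.$$ Proposition. Let $1\le r<n$ and let $A\in\mathbb{R}^{n\times n}$ be symmetric with eigenvalues $\lambda_1\ge\dots\ge\lambda_r>\lambda_{r+1}\ge\dots\ge\lambda_n$ (with multiplicity) and eigenvalue decomposition $A=V\Lambda V^{\mathsf T}+V_\perp\Lambda_\perp V_\perp^{\mathsf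 T}$, where $\Lambda=\mathrm{diag}(\lambda_1,\dots,\lambda_r)$, $\Lambda_\perp=\mathrm{diag}(\lambda_{r+1},\dots,\lambda_n)$, $V\in\mathbb{O}_{n,r}$, $V_\perp\in\mathbb{O}_{n,n-r}$ and $V^{\mathsf T}V_\perp=0$. Let $Q\in\mathbb{O}_{n,r}$, let $S\in\mathbb{R}^{r\times r}$ be diagonal, let $E=AQ-QS$, and let $$\mathsf{gap}=\min\{\lambda_r-\lambda_{r+1},\ \mathsf{sep}_{2\to\infty,V_\perp}(\Lambda,V_\perp\Lambda_\perp V_\perp^{\mathsf T})\}.$$ Suppose that $Q$ is the leading invariant subspace of $A-EQ^{\mathsf T}$, that is, the range of $Q$ is invariant under $A-EQ^{\mathsf T}$ and the eigenvalues of the restriction of $A-EQ^{\mathsf T}$ to it are the $r$ (algebraically) largest eigenvalues of $A-EQ^{\mathsf T}$, counted with algebraic multiplicity (all eigenvalues of this matrix are real). Suppose also that $\|E\|_2\le\mathsf{gap}/5$. Then $$\mathrm{dist}_{2\to\infty}(V,Q)\le 8\,\|V\|_{2\to\infty}\left(\frac{\|E\|_2}{\lambda_r-\lambda_{r+1}}\right)^2+2\,\|V_\perp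 V_\perp^{\mathsf T}\|_\infty\,\frac{\|E\|_{2\to\infty}}{\mathsf{gap}}\left(1+\frac{2\|E\|_2}{\lambda_r-\lambda_{r+1}}\right).$$ -/

import Mathlib

open Matrix

noncomputable section

/-- The set of `n × k` real matrices with orthonormal columns, `UᵀU = I`. -/
def OrthonormalColumns (n k : ℕ) : Set (Matrix (Fin n) (Fin k) ℝ) :=
  {U | Uᵀ * U = 1}

open scoped Matrix.Norms.L2Operator in
/-- The spectral norm `‖M‖₂ = sup {‖M x‖₂ : ‖x‖₂ = 1}` (Mathlib's `ℓ²` operator norm). -/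
def norm2 {m k : ℕ} (M : Matrix (Fin m) (Fin k) ℝ) : ℝ := ‖M‖

/-- The `ℓ_∞ → ℓ_∞` operator norm: the largest `ℓ¹` norm of a row. -/
def normInf {m k : ℕ} (M : Matrix (Fin m) (Fin k) ℝ) : ℝ :=
  ⨆ i, ∑ j, |M i j|

/-- The `ℓ_{2 → ∞}` norm: the largest Euclidean norm of a row. -/
def norm2Inf {m k : ℕ} (M : Matrix (Fin m) (Fin k) ℝ) : ℝ :=
  ⨆ i, √(∑ j, (M i j) ^ 2)

/-- The distance `inf {‖V - W O‖_{2 → ∞} : O ∈ 𝕆_r}`. -/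
def dist2Inf {n r : ℕ} (V W : Matrix (Fin n) (Fin r) ℝ) : ℝ :=
  ⨅ O : OrthonormalColumns r r, norm2Inf (V - W * (O : Matrix (Fin r) (Fin r) ℝ))

/-- The separation of `B` and `C` along the range of `W`, with respect to the norm `N`:
`inf {N (Z B - C Z) : N Z = 1, Z = W Y for some Y}`. -/
def sep {n r k : ℕ} (N : Matrix (Fin n) (Fin r) ℝ → ℝ) (W : Matrix (Fin n) (Fin k) ℝ)
    (B : Matrix (Fin r) (Fin r) ℝ) (C : Matrix (Fin n) (Fin n) ℝ) : ℝ :=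
  sInf {t | ∃ Z : Matrix (Fin n) (Fin r) ℝ,
    N Z = 1 ∧ (∃ Y : Matrix (Fin k) (Fin r) ℝ, Z = W * Y) ∧ t = N (Z * B - C * Z)}

/-- The eigenvalues of a real symmetric matrix in decreasing order, with multiplicity;
the index starts at `0`. -/
def symmEigenvalue {n : ℕ} {A : Matrix (Fin n) (Fin n) ℝ} (hA : A.IsHermitian) (k : Fin n) : ℝ :=
  hA.eigenvalues₀ (Fin.cast (Fintype.card_fin n).symm k)

/-- The complex eigenvalues of a real square matrix, with algebraic multiplicity. -/
def complexEigenvalues {k : ℕ} (M : Matrix (Fin k) (Fin k) ℝ) : Multiset ℂ :=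
  (M.map (algebraMap ℝ ℂ)).charpoly.roots

/-- The columns of `Q` are an orthonormal basis of a leading invariant subspace of the (not
necessarily symmetric) matrix `M`: the range of `Q` is invariant, `M Q = Q T`, and no eigenvalue
among the remaining ones, `R`, exceeds an eigenvalue of the restriction `T` of `M` to that range.
Eigenvalues are counted with algebraic multiplicity and compared by their real parts. -/
def IsLeadingInvariantSubspace {n r : ℕ} (M : Matrix (Fin n) (Fin n) ℝ)
    (Q : Matrix (Fin n) (Fin r) ℝ) : Prop :=
  Q ∈ OrthonormalColumns n r ∧
  ∃ T : Matrix (Fin r) (Fin r) ℝ, M * Q = Q * T ∧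
    ∃ R : Multiset ℂ, complexEigenvalues M = complexEigenvalues T + R ∧
      ∀ μ ∈ complexEigenvalues T, ∀ ν ∈ R, ν.re ≤ μ.re

end

/-! Split `V - Q * O` along the ranges of `V` and `Vp`. With `G = Vᵀ * Q`, the defect `1 - Gᵀ * G`
is the Gram matrix of `Vpᵀ * Q`, so the inverse of the orthogonal polar factor of `G` is a choice of
`O` whose component along `V` is quadratic in the sine `‖Vpᵀ * Q‖`. The other component is `Vp *
(Vpᵀ * Q)` up to rotation (`dist2Inf_le_sq_add`).

Both quantities are governed by the Sylvester equation obtained by applying `Vpᵀ` to `A * Q - Q * S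
= E`. To use it, the Ritz values on the diagonal of `S` must be located. The block-diagonal matrix
built from `S` and the compression of `A` to the complement of `Q` is within `2‖E‖` of `A`
(`norm_sub_blockDiagonal_le`). The leading hypothesis says exactly that the sorted Ritz values `s`
are its top `r` eigenvalues, so Weyl's inequality gives `|l i - s i| ≤ 2‖E‖`
(`abs_leading_diagonal_sub_le`).

The spectral gap then bounds the sine (`mul_l2_opNorm_le_sylvester`). Replacing `s` by `l` costs
`2‖E‖` of the separation, which bounds the transverse part row by row (`sep_sub_mul_norm2Inf_le`).
-/

/-! ### Spectral norm and quadratic forms -/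

section OperatorNorm

open scoped Matrix.Norms.L2Operator

variable {m k l : Type*} [Fintype m] [Fintype k] [Fintype l]
  [DecidableEq k] [DecidableEq l]

theorem l2_opNorm_transpose [DecidableEq m] (M : Matrix m k ℝ) : ‖Mᵀ‖ = ‖M‖ := by
  rw [← conjTranspose_eq_transpose_of_trivial, l2_opNorm_conjTranspose]

theorem l2_opNorm_transpose_mul_self (M : Matrix m k ℝ) : ‖Mᵀ * M‖ = ‖M‖ * ‖M‖ := by
  rw [← conjTranspose_eq_transpose_of_trivial, l2_opNorm_conjTranspose_mul_self]

theorem l2_opNorm_diagonal_le [DecidableEq m] {v : m → ℝ} {c : ℝ} (hc : 0 ≤ c) (h : ∀ i, |v i| ≤ c) :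
    ‖(diagonal v : Matrix m m ℝ)‖ ≤ c := by
  rw [l2_opNorm_diagonal]
  exact (pi_norm_le_iff_of_nonneg hc).2 h

theorem l2_opNorm_le_one {U : Matrix m k ℝ} (hU : Uᵀ * U = 1) : ‖U‖ ≤ 1 := by
  have h1 : ‖(1 : Matrix k k ℝ)‖ ≤ 1 := by
    rw [← diagonal_one]
    exact l2_opNorm_diagonal_le zero_le_one fun i => by simp
  have h2 := l2_opNorm_transpose_mul_self U
  rw [hU] at h2
  nlinarith [norm_nonneg U]

theorem l2_opNorm_mul_le_left {U : Matrix m k ℝ} (hU : ‖U‖ ≤ 1) (M : Matrix k l ℝ) :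
    ‖U * M‖ ≤ ‖M‖ :=
  (l2_opNorm_mul U M).trans (by nlinarith [norm_nonneg M])

theorem l2_opNorm_mul_le_right {U : Matrix k l ℝ} (hU : ‖U‖ ≤ 1) (M : Matrix m k ℝ) :
    ‖M * U‖ ≤ ‖M‖ :=
  (l2_opNorm_mul M U).trans (by nlinarith [norm_nonneg M])

theorem norm_toLp_mulVec_le (M : Matrix m k ℝ) (x : k → ℝ) :
    ‖WithLp.toLp 2 (M *ᵥ x)‖ ≤ ‖M‖ * ‖WithLp.toLp 2 x‖ :=
  l2_opNorm_mulVec M (WithLp.toLp 2 x)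

omit [DecidableEq k] in
theorem norm_toLp_sq (x : k → ℝ) : ‖WithLp.toLp 2 x‖ ^ 2 = x ⬝ᵥ x := by
  rw [EuclideanSpace.real_norm_sq_eq]
  simp [dotProduct, pow_two]

theorem abs_quadraticForm_le (M : Matrix k k ℝ) (x : k → ℝ) :
    |x ⬝ᵥ (M *ᵥ x)| ≤ ‖M‖ * (x ⬝ᵥ x) := by
  have h := abs_real_inner_le_norm (WithLp.toLp 2 (M *ᵥ x)) (WithLp.toLp 2 x)
  have h2 : inner ℝ (WithLp.toLp 2 (M *ᵥ x)) (WithLp.toLp 2 x) = x ⬝ᵥ (M *ᵥ x) := by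
    simp [PiLp.inner_apply, dotProduct]
  rw [h2] at h
  have h3 := norm_toLp_mulVec_le M x
  rw [← norm_toLp_sq]
  nlinarith [norm_nonneg (WithLp.toLp 2 x)]

theorem abs_apply_self_le (M : Matrix k k ℝ) (i : k) : |M i i| ≤ ‖M‖ := by
  simpa using abs_quadraticForm_le M (Pi.single i 1)

end OperatorNorm

/-! ### Row norms and the separation -/

section RowNorm

open scoped Matrix.Norms.L2Operator

variable {n p q : ℕ}

theorem norm2Inf_eq (M : Matrix (Fin n) (Fin p) ℝ) :
    norm2Inf M = ⨆ i, ‖WithLp.toLp 2 (M i)‖ := by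
  simp [norm2Inf, EuclideanSpace.norm_eq]

theorem norm_row_le_norm2Inf (M : Matrix (Fin n) (Fin p) ℝ) (i : Fin n) :
    ‖WithLp.toLp 2 (M i)‖ ≤ norm2Inf M := by
  rw [norm2Inf_eq]
  exact le_ciSup (f := fun i => ‖WithLp.toLp 2 (M i)‖) (Set.finite_range _).bddAbove i

theorem norm2Inf_le {M : Matrix (Fin n) (Fin p) ℝ} {c : ℝ} (hc : 0 ≤ c)
    (h : ∀ i, ‖WithLp.toLp 2 (M i)‖ ≤ c) : norm2Inf M ≤ c := by
  rw [norm2Inf_eq]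
  exact Real.iSup_le h hc

theorem norm2Inf_nonneg (M : Matrix (Fin n) (Fin p) ℝ) : 0 ≤ norm2Inf M := by
  rw [norm2Inf_eq]
  exact Real.iSup_nonneg fun i => norm_nonneg _

theorem normInf_nonneg (M : Matrix (Fin n) (Fin p) ℝ) : 0 ≤ normInf M :=
  Real.iSup_nonneg fun _ => Finset.sum_nonneg fun _ _ => abs_nonneg _

theorem norm2Inf_add_le (M N : Matrix (Fin n) (Fin p) ℝ) :
    norm2Inf (M + N) ≤ norm2Inf M + norm2Inf N :=
  norm2Inf_le (add_nonneg (norm2Inf_nonneg _) (norm2Inf_nonneg _)) fun i =>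
    (norm_add_le (WithLp.toLp 2 (M i)) (WithLp.toLp 2 (N i))).trans
      (add_le_add (norm_row_le_norm2Inf _ _) (norm_row_le_norm2Inf _ _))

theorem norm2Inf_neg (M : Matrix (Fin n) (Fin p) ℝ) : norm2Inf (-M) = norm2Inf M := by
  simp [norm2Inf]

theorem norm2Inf_smul (c : ℝ) (M : Matrix (Fin n) (Fin p) ℝ) :
    norm2Inf (c • M) = |c| * norm2Inf M := by
  rw [norm2Inf_eq, norm2Inf_eq, Real.mul_iSup_of_nonneg (abs_nonneg c)]
  refine congrArg _ (funext fun i => ?_)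
  rw [← Real.norm_eq_abs, ← norm_smul]
  rfl

theorem norm2Inf_mul_le (M : Matrix (Fin n) (Fin p) ℝ) (B : Matrix (Fin p) (Fin q) ℝ) :
    norm2Inf (M * B) ≤ norm2Inf M * ‖B‖ := by
  refine norm2Inf_le (mul_nonneg (norm2Inf_nonneg _) (norm_nonneg _)) fun i => ?_
  have h : (M * B) i = Bᵀ *ᵥ (M i) := by
    rw [mulVec_transpose]; exact mul_apply_eq_vecMul M B i
  rw [h, mul_comm, ← l2_opNorm_transpose B]
  exact (norm_toLp_mulVec_le _ _).trans
    (mul_le_mul_of_nonneg_left (norm_row_le_norm2Inf M i) (norm_nonneg _))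

theorem norm2Inf_mul_le_normInf (B : Matrix (Fin n) (Fin q) ℝ) (M : Matrix (Fin q) (Fin p) ℝ) :
    norm2Inf (B * M) ≤ normInf B * norm2Inf M := by
  refine norm2Inf_le (mul_nonneg (normInf_nonneg _) (norm2Inf_nonneg _)) fun i => ?_
  have h : WithLp.toLp 2 ((B * M) i) = ∑ j, B i j • WithLp.toLp 2 (M j) := by
    ext k
    simp [mul_apply]
  rw [h]
  calc ‖∑ j, B i j • WithLp.toLp 2 (M j)‖ ≤ ∑ j, |B i j| * norm2Inf M :=
        norm_sum_le_of_le _ fun j _ => by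
          rw [norm_smul, Real.norm_eq_abs]
          exact mul_le_mul_of_nonneg_left (norm_row_le_norm2Inf M j) (abs_nonneg _)
    _ = (∑ j, |B i j|) * norm2Inf M := by rw [Finset.sum_mul]
    _ ≤ normInf B * norm2Inf M := by
        refine mul_le_mul_of_nonneg_right ?_ (norm2Inf_nonneg _)
        exact le_ciSup (f := fun i => ∑ j, |B i j|) (Set.finite_range _).bddAbove i

theorem dist2Inf_le {O : Matrix (Fin p) (Fin p) ℝ} (hO : O ∈ OrthonormalColumns p p)
    (V W : Matrix (Fin n) (Fin p) ℝ) : dist2Inf V W ≤ norm2Inf (V - W * O) :=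
  ciInf_le (f := fun O : OrthonormalColumns p p =>
      norm2Inf (V - W * (O : Matrix (Fin p) (Fin p) ℝ)))
    ⟨0, by rintro _ ⟨O, rfl⟩; exact norm2Inf_nonneg _⟩ ⟨O, hO⟩

/-- Homogeneity frees the infimum from its normalization: rescale `W * Y` to unit norm. -/
theorem sep_mul_norm2Inf_le {k : ℕ} (W : Matrix (Fin n) (Fin k) ℝ) (B : Matrix (Fin p) (Fin p) ℝ)
    (C : Matrix (Fin n) (Fin n) ℝ) (Y : Matrix (Fin k) (Fin p) ℝ) :
    sep norm2Inf W B C * norm2Inf (W * Y) ≤ norm2Inf (W * Y * B - C * (W * Y)) := by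
  obtain h0 | h0 := (norm2Inf_nonneg (W * Y)).eq_or_lt
  · rw [← h0, mul_zero]
    exact norm2Inf_nonneg _
  rw [← le_div_iff₀ h0]
  have hinv : |(norm2Inf (W * Y))⁻¹| = (norm2Inf (W * Y))⁻¹ := abs_of_pos (inv_pos.2 h0)
  refine csInf_le (s := {t | ∃ Z : Matrix (Fin n) (Fin p) ℝ, norm2Inf Z = 1 ∧
    (∃ Y : Matrix (Fin k) (Fin p) ℝ, Z = W * Y) ∧ t = norm2Inf (Z * B - C * Z)}) ⟨0, ?_⟩
    ⟨(norm2Inf (W * Y))⁻¹ • (W * Y), ?_, ⟨(norm2Inf (W * Y))⁻¹ • Y, ?_⟩, ?_⟩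
  · rintro _ ⟨Z, -, -, rfl⟩
    exact norm2Inf_nonneg _
  · rw [norm2Inf_smul, hinv, inv_mul_cancel₀ h0.ne']
  · rw [Matrix.mul_smul]
  · rw [Matrix.smul_mul, Matrix.mul_smul, ← smul_sub, norm2Inf_smul, hinv, div_eq_inv_mul]

end RowNorm

/-! ### Orthonormal frames, Weyl's inequality and compressions -/

section Decomposition

theorem mul_transpose_add_mul_transpose_eq_one {n p m : Type*} [Fintype n] [Fintype p] [Fintype m]
    [DecidableEq n] [DecidableEq p] [DecidableEq m] {V : Matrix n p ℝ} {W : Matrix n m ℝ}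
    (hcard : Fintype.card n = Fintype.card p + Fintype.card m)
    (hV : Vᵀ * V = 1) (hW : Wᵀ * W = 1) (hVW : Vᵀ * W = 0) : V * Vᵀ + W * Wᵀ = 1 := by
  have hWV : Wᵀ * V = 0 := by
    simpa using congrArg transpose hVW
  have h : fromRows Vᵀ Wᵀ * fromCols V W = 1 := by
    rw [fromRows_mul_fromCols, hV, hW, hVW, hWV, fromBlocks_one]
  have h' := (mul_eq_one_comm_of_card_eq _ _ _ (by simp [hcard])).1 h
  rwa [fromCols_mul_fromRows] at h'

theorem exists_orthonormalColumns_complement {n r : ℕ} (hrn : r ≤ n)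
    {Q : Matrix (Fin n) (Fin r) ℝ} (hQ : Qᵀ * Q = 1) :
    ∃ W : Matrix (Fin n) (Fin (n - r)) ℝ, Wᵀ * W = 1 ∧ Qᵀ * W = 0 := by
  let v : Fin r ⊕ Fin (n - r) → EuclideanSpace ℝ (Fin n) :=
    Sum.elim (fun j => WithLp.toLp 2 (Q.col j)) 0
  have hv : Orthonormal ℝ ((Set.range Sum.inl).domRestrict v) := by
    rw [orthonormal_iff_ite]
    rintro ⟨_, i, rfl⟩ ⟨_, j, rfl⟩
    have := congrFun (congrFun hQ j) i
    simpa [v, PiLp.inner_apply, mul_apply, one_apply, Subtype.ext_iff, eq_comm] using this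
  obtain ⟨b, hb⟩ := hv.exists_orthonormalBasis_extension_of_card_eq (by simp [hrn])
  have horth := orthonormal_iff_ite.1 b.orthonormal
  refine ⟨of fun i j => b (Sum.inr j) i, ?_, ?_⟩
  · ext i j
    simpa [PiLp.inner_apply, mul_apply, one_apply, eq_comm] using horth (Sum.inr j) (Sum.inr i)
  · ext i j
    have h := horth (Sum.inr j) (Sum.inl i)
    rw [hb (Sum.inl i) ⟨i, rfl⟩] at h
    simpa [v, PiLp.inner_apply, mul_apply] using h

theorem exists_orthogonal_diagonalization {p : Type*} [Fintype p] [DecidableEq p]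
    {B : Matrix p p ℝ} (hB : B.IsHermitian) :
    ∃ U : Matrix p p ℝ, Uᵀ * U = 1 ∧ U * Uᵀ = 1 ∧ B = U * diagonal hB.eigenvalues * Uᵀ := by
  have h1 := mem_unitaryGroup_iff'.1 hB.eigenvectorUnitary.2
  have h2 := mem_unitaryGroup_iff.1 hB.eigenvectorUnitary.2
  have h3 := hB.spectral_theorem
  rw [Unitary.conjStarAlgAut_apply] at h3
  rw [star_eq_conjTranspose, conjTranspose_eq_transpose_of_trivial] at h1 h2
  refine ⟨hB.eigenvectorUnitary, h1, h2, ?_⟩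
  simpa [star_eq_conjTranspose, conjTranspose_eq_transpose_of_trivial] using! h3

theorem dotProduct_conj_mulVec {n p : Type*} [Fintype n] [Fintype p] (V : Matrix n p ℝ)
    (D : Matrix p p ℝ) (x : n → ℝ) :
    x ⬝ᵥ ((V * D * Vᵀ) *ᵥ x) = (Vᵀ *ᵥ x) ⬝ᵥ (D *ᵥ (Vᵀ *ᵥ x)) := by
  rw [← mulVec_mulVec, ← mulVec_mulVec, dotProduct_mulVec, ← mulVec_transpose]

theorem dotProduct_self_eq_add {n p m : Type*} [Fintype n] [Fintype p] [Fintype m]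
    [DecidableEq n] {V : Matrix n p ℝ} {W : Matrix n m ℝ} (h : V * Vᵀ + W * Wᵀ = 1) (x : n → ℝ) :
    x ⬝ᵥ x = (Vᵀ *ᵥ x) ⬝ᵥ (Vᵀ *ᵥ x) + (Wᵀ *ᵥ x) ⬝ᵥ (Wᵀ *ᵥ x) := by
  classical
  have h1 := dotProduct_conj_mulVec V 1 x
  have h2 := dotProduct_conj_mulVec W 1 x
  simp only [Matrix.mul_one, one_mulVec] at h1 h2
  rw [← h1, ← h2, ← dotProduct_add, ← add_mulVec, h, one_mulVec]

theorem dotProduct_diagonal_mulVec_le {p : Type*} [Fintype p] [DecidableEq p] {d : p → ℝ}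
    {c : ℝ} {y : p → ℝ} (h : ∀ i, y i ≠ 0 → d i ≤ c) :
    y ⬝ᵥ (diagonal d *ᵥ y) ≤ c * (y ⬝ᵥ y) := by
  simp only [dotProduct, mulVec_diagonal, Finset.mul_sum]
  refine Finset.sum_le_sum fun i _ => ?_
  by_cases hy : y i = 0
  · simp [hy]
  · nlinarith [h i hy, mul_self_nonneg (y i)]

theorem le_dotProduct_diagonal_mulVec {p : Type*} [Fintype p] [DecidableEq p] {d : p → ℝ}
    {c : ℝ} {y : p → ℝ} (h : ∀ i, y i ≠ 0 → c ≤ d i) :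
    c * (y ⬝ᵥ y) ≤ y ⬝ᵥ (diagonal d *ᵥ y) := by
  simp only [dotProduct, mulVec_diagonal, Finset.mul_sum]
  refine Finset.sum_le_sum fun i _ => ?_
  by_cases hy : y i = 0
  · simp [hy]
  · nlinarith [h i hy, mul_self_nonneg (y i)]

theorem quadraticForm_le_of_eigenvalues_le {p : Type*} [Fintype p] [DecidableEq p]
    {B : Matrix p p ℝ} (hB : B.IsHermitian) {c : ℝ} (h : ∀ i, hB.eigenvalues i ≤ c) (y : p → ℝ) :
    y ⬝ᵥ (B *ᵥ y) ≤ c * (y ⬝ᵥ y) := by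
  obtain ⟨U, -, hU, hBU⟩ := exists_orthogonal_diagonalization hB
  have h1 : y ⬝ᵥ y = (Uᵀ *ᵥ y) ⬝ᵥ (Uᵀ *ᵥ y) := by
    have := dotProduct_conj_mulVec U 1 y
    simpa [hU] using this
  rw [h1, hBU, dotProduct_conj_mulVec]
  exact dotProduct_diagonal_mulVec_le fun i _ => h i

/-- One half of Weyl's inequality, for the `r` leading eigenvalues. -/
theorem leading_diagonal_le_add {n m : Type*} {r : ℕ} [Fintype n] [Fintype m] [DecidableEq n]
    (hcard : Fintype.card n = r + Fintype.card m)
    {V Q : Matrix n (Fin r) ℝ} {V' Q' : Matrix n m ℝ}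
    (hV : V * Vᵀ + V' * V'ᵀ = 1) (hQ : Q * Qᵀ + Q' * Q'ᵀ = 1)
    {l s : Fin r → ℝ} (hl : Antitone l) (hs : Antitone s) {C B : Matrix m m ℝ}
    (hB : ∀ i y, y ⬝ᵥ (B *ᵥ y) ≤ s i * (y ⬝ᵥ y)) {c : ℝ}
    (h : ∀ x, x ⬝ᵥ ((V * diagonal l * Vᵀ + V' * C * V'ᵀ) *ᵥ x) ≤
      x ⬝ᵥ ((Q * diagonal s * Qᵀ + Q' * B * Q'ᵀ) *ᵥ x) + c * (x ⬝ᵥ x)) (i : Fin r) :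
    l i ≤ s i + c := by
  -- A kernel vector of `N` is orthogonal to `V'`, to the columns of `Q` before `i` and to those of
  -- `V` after `i`. These are one condition fewer than the dimension, so a nonzero one exists; on it
  -- the first form is at least `l i` and the second at most `s i`, relative to `x ⬝ᵥ x`.
  let N : Matrix ({j : Fin r // j ≠ i} ⊕ m) n ℝ :=
    fromRows (of fun j => if j.1 < i then Qᵀ j else Vᵀ j) V'ᵀ
  obtain ⟨x, hx, hx0⟩ : ∃ x ∈ LinearMap.ker N.mulVecLin, x ≠ 0 := by
    rw [← Submodule.ne_bot_iff]
    refine LinearMap.ker_ne_bot_of_finrank_lt ?_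
    have : 0 < r := i.pos
    simp [Fintype.card_subtype_compl, hcard]
    omega
  have hN : N *ᵥ x = 0 := hx
  have hV'x : V'ᵀ *ᵥ x = 0 := by
    ext k
    simpa [N, mulVec] using congrFun hN (Sum.inr k)
  have hQx : ∀ j < i, (Qᵀ *ᵥ x) j = 0 := fun j hj => by
    simpa [N, mulVec, hj] using congrFun hN (Sum.inl ⟨j, hj.ne⟩)
  have hVx : ∀ j, i < j → (Vᵀ *ᵥ x) j = 0 := fun j hj => by
    simpa [N, mulVec, hj.not_gt] using congrFun hN (Sum.inl ⟨j, hj.ne'⟩)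
  have hpos : 0 < x ⬝ᵥ x := by
    simpa using dotProduct_star_self_pos_iff.2 hx0
  have h1 : l i * (x ⬝ᵥ x) ≤ x ⬝ᵥ ((V * diagonal l * Vᵀ + V' * C * V'ᵀ) *ᵥ x) := by
    rw [add_mulVec, dotProduct_add, dotProduct_conj_mulVec, dotProduct_conj_mulVec,
      dotProduct_self_eq_add hV, hV'x]
    simp only [zero_dotProduct, add_zero]
    exact le_dotProduct_diagonal_mulVec fun j hj => hl (not_lt.1 fun hij => hj (hVx j hij))
  have h2 : x ⬝ᵥ ((Q * diagonal s * Qᵀ + Q' * B * Q'ᵀ) *ᵥ x) ≤ s i * (x ⬝ᵥ x) := by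
    rw [add_mulVec, dotProduct_add, dotProduct_conj_mulVec, dotProduct_conj_mulVec,
      dotProduct_self_eq_add hQ, mul_add]
    exact add_le_add
      (dotProduct_diagonal_mulVec_le fun j hj => hs (not_lt.1 fun hij => hj (hQx j hij))) (hB i _)
  have h3 := h x
  nlinarith

/-- In the orthonormal basis formed by the columns of `Q` and `W`, `M` is block upper triangular, so
its characteristic polynomial factors. -/
theorem complexEigenvalues_eq_add {n r m : ℕ} (hcard : n = r + m)
    {M : Matrix (Fin n) (Fin n) ℝ} {Q : Matrix (Fin n) (Fin r) ℝ} {W : Matrix (Fin n) (Fin m) ℝ}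
    {S : Matrix (Fin r) (Fin r) ℝ} (hQ : Qᵀ * Q = 1) (hW : Wᵀ * W = 1) (hQW : Qᵀ * W = 0)
    (hMQ : M * Q = Q * S) :
    complexEigenvalues M = complexEigenvalues S + complexEigenvalues (Wᵀ * M * W) := by
  have hone := mul_transpose_add_mul_transpose_eq_one (by simpa using hcard) hQ hW hQW
  have hWQ : Wᵀ * Q = 0 := by simpa using congrArg transpose hQW
  have hchar : M.charpoly = S.charpoly * (Wᵀ * M * W).charpoly := by
    rw [← charpoly_fromBlocks_zero₂₁ S (Qᵀ * M * W) (Wᵀ * M * W)]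
    have h1 : fromBlocks S (Qᵀ * M * W) 0 (Wᵀ * M * W) =
        fromRows Qᵀ Wᵀ * (M * fromCols Q W) := by
      rw [mul_fromCols, fromRows_mul_fromCols, hMQ, ← Matrix.mul_assoc, hQ, Matrix.one_mul,
        ← Matrix.mul_assoc Wᵀ, hWQ, Matrix.zero_mul, Matrix.mul_assoc, Matrix.mul_assoc]
    rw [h1, charpoly_mul_comm_of_le _ _ (by simp [hcard]), Matrix.mul_assoc,
      fromCols_mul_fromRows, hone]
    simp [hcard]
  unfold complexEigenvalues
  rw [charpoly_map, charpoly_map, charpoly_map, hchar, Polynomial.map_mul, Polynomial.roots_mul]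
  exact mul_ne_zero (((charpoly_monic _).map _).ne_zero) (((charpoly_monic _).map _).ne_zero)

theorem ofReal_eigenvalues_mem_complexEigenvalues {m : ℕ} {B : Matrix (Fin m) (Fin m) ℝ}
    (hB : B.IsHermitian) (i : Fin m) : (hB.eigenvalues i : ℂ) ∈ complexEigenvalues B := by
  unfold complexEigenvalues
  rw [charpoly_map, Polynomial.mem_roots (((charpoly_monic _).map _).ne_zero)]
  refine Polynomial.IsRoot.map ?_
  rw [hB.charpoly_eq, Polynomial.IsRoot, Polynomial.eval_prod]
  refine Finset.prod_eq_zero (Finset.mem_univ i) ?_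
  rw [Polynomial.eval_sub, Polynomial.eval_X, Polynomial.eval_C]
  exact sub_self _

theorem ofReal_mem_complexEigenvalues_diagonal {m : ℕ} (d : Fin m → ℝ) (i : Fin m) :
    (d i : ℂ) ∈ complexEigenvalues (diagonal d) := by
  unfold complexEigenvalues
  rw [charpoly_map, Polynomial.mem_roots (((charpoly_monic _).map _).ne_zero)]
  refine Polynomial.IsRoot.map ?_
  rw [charpoly_diagonal, Polynomial.IsRoot, Polynomial.eval_prod]
  exact Finset.prod_eq_zero (Finset.mem_univ i) (by simp)

/-- If `Q` spans a leading invariant subspace of `M` on which `M` acts as `diagonal d`, then the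
compression of `M` to the orthogonal complement, if symmetric, is bounded by every `d i`. -/
theorem IsLeadingInvariantSubspace.quadraticForm_compl_le {n r m : ℕ} (hcard : n = r + m)
    {M : Matrix (Fin n) (Fin n) ℝ} {Q : Matrix (Fin n) (Fin r) ℝ} {W : Matrix (Fin n) (Fin m) ℝ}
    {d : Fin r → ℝ} (hlead : IsLeadingInvariantSubspace M Q) (hW : Wᵀ * W = 1)
    (hQW : Qᵀ * W = 0) (hMQ : M * Q = Q * diagonal d) (hB : (Wᵀ * M * W).IsHermitian)
    (i : Fin r) (y : Fin m → ℝ) :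
    y ⬝ᵥ ((Wᵀ * M * W) *ᵥ y) ≤ d i * (y ⬝ᵥ y) := by
  obtain ⟨hQ, T, hT, R, hR, hle⟩ := hlead
  have hQ' : Qᵀ * Q = 1 := hQ
  have hTd : T = diagonal d := by
    have := congrArg (Qᵀ * ·) (hT.symm.trans hMQ)
    simpa [← Matrix.mul_assoc, hQ'] using this
  subst hTd
  -- Cancelling in multisets identifies the remaining eigenvalues `R` with those of the compression.
  rw [complexEigenvalues_eq_add hcard hQ hW hQW hMQ, add_right_inj] at hR
  refine quadraticForm_le_of_eigenvalues_le hB (fun j => ?_) y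
  exact hle _ (ofReal_mem_complexEigenvalues_diagonal d i) _
    (hR ▸ ofReal_eigenvalues_mem_complexEigenvalues hB j)

end Decomposition

/-! ### Sylvester bound, nearest orthogonal matrix, block-diagonal approximation -/

section Perturbation

open scoped Matrix.Norms.L2Operator

/-- The two spectra lie on opposite sides of a gap. After a common shift, which leaves the Sylvester
operator unchanged, right multiplication expands by at least `b` and left multiplication has norm at
most `b - η`; the triangle inequality gives constant one. -/
theorem mul_l2_opNorm_le_sylvester {p m : Type*} [Fintype p] [Fintype m] [DecidableEq p]
    [DecidableEq m] {d : p → ℝ} {e : m → ℝ} {a η : ℝ} (hη : 0 < η) (hd : ∀ i, a + η ≤ d i)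
    (he : ∀ k, e k ≤ a) (X : Matrix m p ℝ) :
    η * ‖X‖ ≤ ‖X * diagonal d - diagonal e * X‖ := by
  obtain ⟨c, hac, hec⟩ : ∃ c : ℝ, 0 ≤ a + c ∧ ∀ k, 0 ≤ e k + c := by
    -- The term `|a|` keeps `a + c` nonnegative even when `m` is empty.
    refine ⟨|a| + ∑ k, |e k|, ?_, fun k => ?_⟩
    · have : 0 ≤ ∑ k, |e k| := Finset.sum_nonneg fun _ _ => abs_nonneg _
      linarith [neg_abs_le a]
    · have := Finset.single_le_sum (f := fun k => |e k|) (fun _ _ => abs_nonneg _)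
        (Finset.mem_univ k)
      linarith [neg_abs_le (e k), abs_nonneg a]
  set b := a + c + η with hb
  have hbpos : 0 < b := by linarith
  have hdb : ∀ i, b ≤ d i + c := fun i => by linarith [hd i]
  have hX : X = X * diagonal (fun i => d i + c) * diagonal fun i => (d i + c)⁻¹ := by
    rw [Matrix.mul_assoc, diagonal_mul_diagonal]
    have : (fun i => (d i + c) * (d i + c)⁻¹) = fun _ => (1 : ℝ) :=
      funext fun i => mul_inv_cancel₀ (hbpos.trans_le (hdb i)).ne'
    rw [this, diagonal_one, Matrix.mul_one]
  have hinv : ‖(diagonal fun i => (d i + c)⁻¹ : Matrix p p ℝ)‖ ≤ b⁻¹ :=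
    l2_opNorm_diagonal_le (inv_nonneg.2 hbpos.le) fun i => by
      rw [abs_of_pos (inv_pos.2 (hbpos.trans_le (hdb i)))]
      exact inv_anti₀ hbpos (hdb i)
  have hlow : b * ‖X‖ ≤ ‖X * diagonal (fun i => d i + c)‖ := by
    have h1 : ‖X‖ ≤ ‖X * diagonal (fun i => d i + c)‖ * b⁻¹ := by
      conv_lhs => rw [hX]
      exact (l2_opNorm_mul _ _).trans (mul_le_mul_of_nonneg_left hinv (norm_nonneg _))
    rw [← div_eq_mul_inv, le_div_iff₀ hbpos] at h1
    linarith
  have hup : ‖(diagonal fun k => e k + c) * X‖ ≤ (a + c) * ‖X‖ :=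
    (l2_opNorm_mul _ _).trans <| mul_le_mul_of_nonneg_right
      (l2_opNorm_diagonal_le hac fun k => by
        rw [abs_of_nonneg (hec k)]
        linarith [he k]) (norm_nonneg _)
  have hsplit : X * diagonal (fun i => d i + c) =
      (X * diagonal d - diagonal e * X) + (diagonal fun k => e k + c) * X := by
    ext k i
    simp only [mul_diagonal, diagonal_mul, Matrix.add_apply, Matrix.sub_apply]
    ring
  have htri := norm_add_le (X * diagonal d - diagonal e * X) ((diagonal fun k => e k + c) * X)
  rw [← hsplit] at htri
  linarith

/-- A matrix whose Gram matrix is close to the identity is close to an orthogonal matrix. -/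
theorem exists_orthogonal_norm_one_sub_mul_le {p : Type*} [Fintype p] [DecidableEq p]
    {G : Matrix p p ℝ} {t : ℝ} (ht : t < 1) (hG : ‖1 - Gᵀ * G‖ ≤ t) :
    ∃ O : Matrix p p ℝ, Oᵀ * O = 1 ∧ ‖1 - G * O‖ ≤ t := by
  have hherm : (Gᵀ * G).IsHermitian := by
    rw [← conjTranspose_eq_transpose_of_trivial]
    exact isHermitian_conjTranspose_mul_self G
  obtain ⟨U, hU1, hU2, hGU⟩ := exists_orthogonal_diagonalization hherm
  set d := hherm.eigenvalues
  have hUn : ‖U‖ ≤ 1 := l2_opNorm_le_one hU1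
  have hUtn : ‖Uᵀ‖ ≤ 1 := (l2_opNorm_transpose U).trans_le hUn
  have hUGU : Uᵀ * (Gᵀ * G) * U = diagonal d := by
    rw [hGU]
    calc Uᵀ * (U * diagonal d * Uᵀ) * U = (Uᵀ * U) * diagonal d * (Uᵀ * U) := by
          simp only [Matrix.mul_assoc]
      _ = diagonal d := by rw [hU1, Matrix.one_mul, Matrix.mul_one]
  have hdt : ∀ i, |1 - d i| ≤ t := fun i => by
    have h1 : Uᵀ * (1 - Gᵀ * G) * U = diagonal fun i => 1 - d i := by
      rw [Matrix.mul_sub, Matrix.sub_mul, hUGU, Matrix.mul_one, hU1, ← diagonal_one, diagonal_sub]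
    have h2 := abs_apply_self_le (Uᵀ * (1 - Gᵀ * G) * U) i
    rw [h1, diagonal_apply_eq, ← h1] at h2
    exact h2.trans ((l2_opNorm_mul_le_right hUn _).trans ((l2_opNorm_mul_le_left hUtn _).trans hG))
  have hdpos : ∀ i, 0 < d i := fun i => by linarith [(abs_le.1 (hdt i)).2]
  have hsqrt : ∀ i, 0 < √(d i) := fun i => Real.sqrt_pos.2 (hdpos i)
  -- `G = N * diagonal √d * Uᵀ` is a singular value decomposition, and `U * Nᵀ` inverts the
  -- orthogonal polar factor of `G`.
  let N : Matrix p p ℝ := G * U * diagonal fun i => (√(d i))⁻¹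
  have hN1 : Nᵀ * N = 1 := by
    have : Nᵀ * N = (diagonal fun i => (√(d i))⁻¹) * (Uᵀ * (Gᵀ * G) * U) *
        diagonal fun i => (√(d i))⁻¹ := by
      simp only [N, transpose_mul, diagonal_transpose, Matrix.mul_assoc]
    rw [this, hUGU, diagonal_mul_diagonal, diagonal_mul_diagonal, ← diagonal_one]
    congr 1
    funext i
    have := Real.mul_self_sqrt (hdpos i).le
    field_simp [(hsqrt i).ne']
    nlinarith
  have hN2 : N * Nᵀ = 1 := mul_eq_one_comm.1 hN1
  have hGUN : G * U = N * diagonal fun i => √(d i) := by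
    simp only [N]
    rw [Matrix.mul_assoc (G * U), diagonal_mul_diagonal]
    have : (fun i => (√(d i))⁻¹ * √(d i)) = fun _ => (1 : ℝ) :=
      funext fun i => inv_mul_cancel₀ (hsqrt i).ne'
    rw [this, diagonal_one, Matrix.mul_one]
  refine ⟨U * Nᵀ, ?_, ?_⟩
  · calc (U * Nᵀ)ᵀ * (U * Nᵀ) = N * (Uᵀ * U) * Nᵀ := by
          simp only [transpose_mul, transpose_transpose, Matrix.mul_assoc]
      _ = 1 := by rw [hU1, Matrix.mul_one, hN2]
  · have h1 : 1 - G * (U * Nᵀ) = N * (diagonal fun i => 1 - √(d i)) * Nᵀ := by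
      have : (diagonal fun i => 1 - √(d i)) = (1 : Matrix p p ℝ) - diagonal fun i => √(d i) := by
        rw [← diagonal_one, diagonal_sub]
      rw [this, Matrix.mul_sub, Matrix.sub_mul, Matrix.mul_one, hN2, ← hGUN, Matrix.mul_assoc]
    have hNn : ‖N‖ ≤ 1 := l2_opNorm_le_one hN1
    rw [h1]
    refine (l2_opNorm_mul_le_right ((l2_opNorm_transpose N).trans_le hNn) _).trans
      ((l2_opNorm_mul_le_left hNn _).trans (l2_opNorm_diagonal_le ((norm_nonneg _).trans hG) ?_))
    intro i
    refine le_trans ?_ (hdt i)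
    -- The second factor is at least one, so taking the square root only brings `d i` closer to one.
    have h2 : 1 - d i = (1 - √(d i)) * (1 + √(d i)) := by
      nlinarith [Real.mul_self_sqrt (hdpos i).le]
    rw [h2, abs_mul, abs_of_pos (a := 1 + √(d i)) (by linarith [hsqrt i])]
    nlinarith [abs_nonneg (1 - √(d i)), hsqrt i]

/-- Weyl's inequality pairs sorted values, whereas the diagonal of `S` comes in arbitrary order; `P`
is the sorting permutation. -/
theorem exists_antitone_diagonalization {r : ℕ} (d : Fin r → ℝ) :
    ∃ (P : Matrix (Fin r) (Fin r) ℝ) (s : Fin r → ℝ), Pᵀ * P = 1 ∧ P * Pᵀ = 1 ∧ Antitone s ∧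
      diagonal d = P * diagonal s * Pᵀ ∧
        (∀ j, ∃ i, d j = s i) ∧ ∀ i, ∃ j, s i = d j := by
  let σ := Tuple.sort fun i => -d i
  let P : Matrix (Fin r) (Fin r) ℝ := (1 : Matrix (Fin r) (Fin r) ℝ).submatrix id σ
  have h1 : Pᵀ * P = 1 := by
    simp only [P, transpose_submatrix, transpose_one]
    exact (submatrix_mul_equiv 1 1 σ (Equiv.refl _) σ).trans (by simp)
  have h2 : P * Pᵀ = 1 := mul_eq_one_comm.1 h1
  refine ⟨P, d ∘ σ, h1, h2, fun i j hij => ?_, ?_, fun j => ⟨σ.symm j, by simp⟩,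
    fun i => ⟨σ i, rfl⟩⟩
  · have := Tuple.monotone_sort (fun i => -d i) hij
    simpa using this
  · have h3 : diagonal d * P = P * diagonal (d ∘ σ) := by
      ext i j
      simp only [P, diagonal_mul, mul_diagonal, submatrix_apply, one_apply, id, Function.comp]
      split_ifs with h
      · simp [h]
      · simp
    rw [← h3, Matrix.mul_assoc, h2, Matrix.mul_one]

/-- `A` differs from its block-diagonal part, with the leading block replaced by `S`, by at most
twice the norm of the residual `A Q - Q S`. -/
theorem norm_sub_blockDiagonal_le {n p m : Type*} [Fintype n] [Fintype p] [Fintype m]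
    [DecidableEq n] [DecidableEq p] [DecidableEq m] {A : Matrix n n ℝ} (hA : Aᵀ = A)
    {Q E : Matrix n p ℝ} {W : Matrix n m ℝ} {S : Matrix p p ℝ}
    (hQ : Qᵀ * Q = 1) (hW : Wᵀ * W = 1) (hQW : Qᵀ * W = 0) (hone : Q * Qᵀ + W * Wᵀ = 1)
    (hE : A * Q - Q * S = E) :
    ‖A - (Q * S * Qᵀ + W * (Wᵀ * A * W) * Wᵀ)‖ ≤ 2 * ‖E‖ := by
  have hQA : Qᵀ * A = Eᵀ + Sᵀ * Qᵀ := by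
    have := congrArg transpose hE
    simp only [transpose_sub, transpose_mul, hA] at this
    rw [← this, sub_add_cancel]
  have h1 : A * Q = E + Q * S := by rw [← hE, sub_add_cancel]
  have h2 : Qᵀ * A * W = Eᵀ * W := by
    rw [hQA, Matrix.add_mul, Matrix.mul_assoc, hQW, Matrix.mul_zero, add_zero]
  have hA' : A = A * (Q * Qᵀ) + (Q * Qᵀ + W * Wᵀ) * A * (W * Wᵀ) := by
    rw [hone, Matrix.one_mul, ← Matrix.mul_add, hone, Matrix.mul_one]
  -- Symmetry of `A` turns the block `Qᵀ * A * W` into `Eᵀ * W`, so the whole difference is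
  -- expressed by the residual.
  have key : A - (Q * S * Qᵀ + W * (Wᵀ * A * W) * Wᵀ) = E * Qᵀ + Q * (Eᵀ * (W * Wᵀ)) := by
    have h3 : A * (Q * Qᵀ) = E * Qᵀ + Q * S * Qᵀ := by
      rw [← Matrix.mul_assoc, h1, Matrix.add_mul]
    have h4 : (Q * Qᵀ + W * Wᵀ) * A * (W * Wᵀ) =
        Q * (Eᵀ * (W * Wᵀ)) + W * (Wᵀ * A * W) * Wᵀ := by
      rw [← Matrix.mul_assoc Eᵀ, ← h2]
      simp only [Matrix.add_mul, Matrix.mul_assoc]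
    rw [h3, h4] at hA'
    rw [sub_eq_iff_eq_add]
    exact hA'.trans (by abel)
  have hQn : ‖Q‖ ≤ 1 := l2_opNorm_le_one hQ
  have hWn : ‖W‖ ≤ 1 := l2_opNorm_le_one hW
  have hWtn : ‖Wᵀ‖ ≤ 1 := (l2_opNorm_transpose W).trans_le hWn
  have hPn : ‖W * Wᵀ‖ ≤ 1 := (l2_opNorm_mul_le_right hWtn _).trans hWn
  rw [key, two_mul]
  refine (norm_add_le _ _).trans (add_le_add ?_ ?_)
  · exact l2_opNorm_mul_le_right ((l2_opNorm_transpose Q).trans_le hQn) _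
  · exact (l2_opNorm_mul_le_left hQn _).trans
      ((l2_opNorm_mul_le_right hPn _).trans (l2_opNorm_transpose E).le)

end Perturbation

/-! ### Ritz values, splitting of the distance, transverse bound -/

section Bounds

open scoped Matrix.Norms.L2Operator

/-- The leading diagonal blocks of two nearby symmetric matrices have nearby sorted entries. -/
theorem abs_leading_diagonal_sub_le {n m : Type*} {r : ℕ} [Fintype n] [Fintype m] [DecidableEq n]
    (hcard : Fintype.card n = r + Fintype.card m)
    {V Q : Matrix n (Fin r) ℝ} {V' Q' : Matrix n m ℝ}
    (hV : V * Vᵀ + V' * V'ᵀ = 1) (hQ : Q * Qᵀ + Q' * Q'ᵀ = 1)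
    {l s : Fin r → ℝ} (hl : Antitone l) (hs : Antitone s) {C B : Matrix m m ℝ}
    (hC : ∀ i y, y ⬝ᵥ (C *ᵥ y) ≤ l i * (y ⬝ᵥ y)) (hB : ∀ i y, y ⬝ᵥ (B *ᵥ y) ≤ s i * (y ⬝ᵥ y))
    {c : ℝ}
    (h : ‖V * diagonal l * Vᵀ + V' * C * V'ᵀ - (Q * diagonal s * Qᵀ + Q' * B * Q'ᵀ)‖ ≤ c)
    (i : Fin r) : |l i - s i| ≤ c := by
  have hx : ∀ x : n → ℝ, |x ⬝ᵥ ((V * diagonal l * Vᵀ + V' * C * V'ᵀ) *ᵥ x) -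
      x ⬝ᵥ ((Q * diagonal s * Qᵀ + Q' * B * Q'ᵀ) *ᵥ x)| ≤ c * (x ⬝ᵥ x) := fun x => by
    rw [← dotProduct_sub, ← sub_mulVec]
    refine (abs_quadraticForm_le _ x).trans (mul_le_mul_of_nonneg_right h ?_)
    simpa using dotProduct_star_self_nonneg x
  have h1 := leading_diagonal_le_add hcard hV hQ hl hs (C := C) hB (c := c)
    (fun x => by linarith [(abs_le.1 (hx x)).2]) i
  have h2 := leading_diagonal_le_add hcard hQ hV hs hl (C := B) hC (c := c)
    (fun x => by linarith [(abs_le.1 (hx x)).1]) i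
  exact abs_le.2 ⟨by linarith, by linarith⟩

/-- The part of the distance between two orthonormal frames that lies along the first of them is
quadratic in the sine of the angle, and the part transverse to it is the compression. -/
theorem dist2Inf_le_sq_add {n r m : ℕ} {V Q : Matrix (Fin n) (Fin r) ℝ}
    {W : Matrix (Fin n) (Fin m) ℝ} (hQ : Qᵀ * Q = 1)
    (hone : V * Vᵀ + W * Wᵀ = 1) (hlt : ‖Wᵀ * Q‖ < 1) :
    dist2Inf V Q ≤ norm2Inf V * ‖Wᵀ * Q‖ ^ 2 + norm2Inf (W * (Wᵀ * Q)) := by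
  have hG : ‖1 - (Vᵀ * Q)ᵀ * (Vᵀ * Q)‖ ≤ ‖Wᵀ * Q‖ ^ 2 := by
    have h : 1 - (Vᵀ * Q)ᵀ * (Vᵀ * Q) = (Wᵀ * Q)ᵀ * (Wᵀ * Q) := by
      rw [sub_eq_iff_eq_add, ← hQ]
      calc Qᵀ * Q = Qᵀ * (V * Vᵀ + W * Wᵀ) * Q := by rw [hone, Matrix.mul_one]
        _ = _ := by
          simp only [transpose_mul, transpose_transpose, Matrix.mul_add, Matrix.add_mul,
            Matrix.mul_assoc]
          rw [add_comm]
    rw [h, l2_opNorm_transpose_mul_self, pow_two]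
  obtain ⟨O, hO, hGO⟩ := exists_orthogonal_norm_one_sub_mul_le
    (by nlinarith [norm_nonneg (Wᵀ * Q)]) hG
  refine (dist2Inf_le hO V Q).trans ?_
  have hsplit : V - Q * O = V * (1 - Vᵀ * Q * O) + -(W * (Wᵀ * Q) * O) := by
    have h : Q * O = V * (Vᵀ * Q * O) + W * (Wᵀ * Q) * O := by
      calc Q * O = (V * Vᵀ + W * Wᵀ) * (Q * O) := by rw [hone, Matrix.one_mul]
        _ = _ := by simp only [Matrix.add_mul, Matrix.mul_assoc]
    rw [Matrix.mul_sub, Matrix.mul_one]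
    conv_lhs => rw [h]
    abel
  rw [hsplit]
  refine (norm2Inf_add_le _ _).trans (add_le_add ?_ ?_)
  · exact (norm2Inf_mul_le _ _).trans (mul_le_mul_of_nonneg_left hGO (norm2Inf_nonneg _))
  · rw [norm2Inf_neg]
    exact (norm2Inf_mul_le _ _).trans
      (mul_le_of_le_one_right (norm2Inf_nonneg _) (l2_opNorm_le_one hO))

/-- The compression of an approximate invariant subspace to a complementary invariant subspace is
controlled by the separation, when the Ritz values are close to the entries of `diagonal l`. -/
theorem sep_sub_mul_norm2Inf_le {n r m : ℕ} {A : Matrix (Fin n) (Fin n) ℝ}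
    {Q E : Matrix (Fin n) (Fin r) ℝ} {W : Matrix (Fin n) (Fin m) ℝ} {C : Matrix (Fin m) (Fin m) ℝ}
    (hW : Wᵀ * W = 1) (hWA : Wᵀ * A = C * Wᵀ) {d l s : Fin r → ℝ}
    (hE : A * Q - Q * diagonal d = E) {P : Matrix (Fin r) (Fin r) ℝ} (hP1 : Pᵀ * P = 1)
    (hP2 : P * Pᵀ = 1) (hd : diagonal d = P * diagonal s * Pᵀ) {c : ℝ} (hc : 0 ≤ c)
    (hls : ∀ i, |l i - s i| ≤ c) :
    (sep norm2Inf W (diagonal l) (W * C * Wᵀ) - c) * norm2Inf (W * (Wᵀ * Q)) ≤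
      normInf (W * Wᵀ) * norm2Inf E := by
  have hPn : ‖P‖ ≤ 1 := l2_opNorm_le_one hP1
  have hPtn : ‖Pᵀ‖ ≤ 1 := (l2_opNorm_transpose P).trans_le hPn
  -- Rotating by `P` puts the Ritz values in the order of `l`, so `diagonal l - diagonal s` has norm
  -- at most `c`.
  set Y := Wᵀ * Q * P with hY
  have hdP : diagonal d * P = P * diagonal s := by
    rw [hd, Matrix.mul_assoc, hP1, Matrix.mul_one]
  have hCY : C * Y = Wᵀ * E * P + Y * diagonal s := by
    calc C * Y = Wᵀ * (A * Q) * P := by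
          rw [hY, ← Matrix.mul_assoc Wᵀ, hWA]; simp only [Matrix.mul_assoc]
      _ = Wᵀ * (E + Q * diagonal d) * P := by rw [← hE, sub_add_cancel]
      _ = Wᵀ * E * P + Wᵀ * Q * (diagonal d * P) := by
          simp only [Matrix.mul_add, Matrix.add_mul, Matrix.mul_assoc]
      _ = _ := by rw [hdP, hY]; simp only [Matrix.mul_assoc]
  have hres : W * Y * diagonal l - W * C * Wᵀ * (W * Y) =
      W * Y * (diagonal fun i => l i - s i) + -(W * Wᵀ * (E * P)) := by
    have h1 : W * C * Wᵀ * (W * Y) = W * (C * Y) := by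
      calc W * C * Wᵀ * (W * Y) = W * C * ((Wᵀ * W) * Y) := by simp only [Matrix.mul_assoc]
        _ = _ := by rw [hW, Matrix.one_mul, Matrix.mul_assoc]
    have h2 : (diagonal fun i => l i - s i) = diagonal l - diagonal s := (diagonal_sub _ _).symm
    rw [h1, hCY, h2, Matrix.mul_sub, Matrix.mul_add]
    simp only [Matrix.mul_assoc]
    abel
  have hsep := sep_mul_norm2Inf_le W (diagonal l) (W * C * Wᵀ) Y
  rw [hres] at hsep
  have h1 : norm2Inf (W * Y * diagonal fun i => l i - s i) ≤ norm2Inf (W * Y) * c :=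
    (norm2Inf_mul_le _ _).trans
      (mul_le_mul_of_nonneg_left (l2_opNorm_diagonal_le hc hls) (norm2Inf_nonneg _))
  have h2 : norm2Inf (-(W * Wᵀ * (E * P))) ≤ normInf (W * Wᵀ) * norm2Inf E := by
    rw [norm2Inf_neg]
    exact (norm2Inf_mul_le_normInf _ _).trans (mul_le_mul_of_nonneg_left
      ((norm2Inf_mul_le _ _).trans (mul_le_of_le_one_right (norm2Inf_nonneg _) hPn))
      (normInf_nonneg _))
  have h3 := norm2Inf_add_le (W * Y * diagonal fun i => l i - s i) (-(W * Wᵀ * (E * P)))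
  have h4 : norm2Inf (W * Y) = norm2Inf (W * (Wᵀ * Q)) := by
    have h5 : W * Y = W * (Wᵀ * Q) * P := by rw [hY]; simp only [Matrix.mul_assoc]
    have h6 : W * (Wᵀ * Q) = W * Y * Pᵀ := by
      rw [h5, Matrix.mul_assoc _ P, hP2, Matrix.mul_one]
    refine le_antisymm ?_ ?_
    · rw [h5]
      exact (norm2Inf_mul_le _ _).trans (mul_le_of_le_one_right (norm2Inf_nonneg _) hPn)
    · rw [h6]
      exact (norm2Inf_mul_le _ _).trans (mul_le_of_le_one_right (norm2Inf_nonneg _) hPtn)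
  rw [h4] at hsep h1
  nlinarith

end Bounds

/-! ### The perturbation bound -/

section

open scoped Matrix.Norms.L2Operator

theorem proposition3 (n r : ℕ) (hr : 1 ≤ r) (hrn : r < n)
    (A : Matrix (Fin n) (Fin n) ℝ) (hA : A.IsHermitian)
    -- the eigenvalues of `A` at the positions `r` and `r + 1`, and the assumed eigengap
    (lamr lamr1 : ℝ)
    (hlamr : lamr = symmEigenvalue hA ⟨r - 1, by omega⟩)
    (hlamr1 : lamr1 = symmEigenvalue hA ⟨r, hrn⟩)
    (hlt : lamr1 < lamr)
    -- the eigenvalue decomposition of `A`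
    (V : Matrix (Fin n) (Fin r) ℝ) (Vp : Matrix (Fin n) (Fin (n - r)) ℝ)
    (hV : V ∈ OrthonormalColumns n r) (hVp : Vp ∈ OrthonormalColumns n (n - r))
    (hVVp : Vᵀ * Vp = 0)
    (L : Matrix (Fin r) (Fin r) ℝ) (Lp : Matrix (Fin (n - r)) (Fin (n - r)) ℝ)
    (hL : L = Matrix.diagonal fun i : Fin r => symmEigenvalue hA ⟨i, by omega⟩)
    (hLp : Lp = Matrix.diagonal fun j : Fin (n - r) => symmEigenvalue hA ⟨r + j, by omega⟩)
    (hdecomp : A = V * L * Vᵀ + Vp * Lp * Vpᵀ)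
    -- the approximate invariant subspace and its residual
    (Q : Matrix (Fin n) (Fin r) ℝ) (hQ : Q ∈ OrthonormalColumns n r)
    (S : Matrix (Fin r) (Fin r) ℝ) (hS : S.IsDiag)
    (E : Matrix (Fin n) (Fin r) ℝ) (hE : A * Q - Q * S = E)
    (gap : ℝ)
    (hgap : gap = min (lamr - lamr1) (sep norm2Inf Vp L (Vp * Lp * Vpᵀ)))
    (hlead : IsLeadingInvariantSubspace (A - E * Qᵀ) Q)
    (hEgap : norm2 E ≤ gap / 5) :
    dist2Inf V Q ≤
      8 * norm2Inf V * (norm2 E / (lamr - lamr1)) ^ 2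
        + 2 * normInf (Vp * Vpᵀ) * (norm2Inf E / gap) * (1 + 2 * norm2 E / (lamr - lamr1)) := by
  have hVp' : Vpᵀ * Vp = 1 := hVp
  have hV' : Vᵀ * V = 1 := hV
  have hQ' : Qᵀ * Q = 1 := hQ
  have hVpV : Vpᵀ * V = 0 := by simpa using congrArg transpose hVVp
  have hcard : n = r + (n - r) := by omega
  have hcard' : Fintype.card (Fin n) = r + Fintype.card (Fin (n - r)) := by simpa using hcard
  have hAt : Aᵀ = A := by
    rw [← conjTranspose_eq_transpose_of_trivial]
    exact hA
  set l : Fin r → ℝ := fun i => symmEigenvalue hA ⟨i, by omega⟩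
  set e : Fin (n - r) → ℝ := fun j => symmEigenvalue hA ⟨r + j, by omega⟩
  set d : Fin r → ℝ := S.diag
  have hSd : S = diagonal d := (isDiag_iff_diagonal_diag S).1 hS |>.symm
  rw [hSd] at hE
  have hanti : Antitone (symmEigenvalue hA) := fun i j hij =>
    hA.eigenvalues₀_antitone (by simpa using hij)
  have hlanti : Antitone l := fun i j hij => hanti (by simpa using hij)
  have hlr : ∀ i, lamr ≤ l i := fun i => by
    rw [hlamr]
    exact hanti (Fin.mk_le_mk.2 (by omega))
  have her : ∀ k, e k ≤ lamr1 := fun k => by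
    rw [hlamr1]
    exact hanti (Fin.mk_le_mk.2 (by omega))
  have hVone := mul_transpose_add_mul_transpose_eq_one (by simpa using hcard) hV' hVp' hVVp
  obtain ⟨W, hW, hQW⟩ := exists_orthonormalColumns_complement hrn.le hQ'
  have hQone := mul_transpose_add_mul_transpose_eq_one (by simpa using hcard) hQ' hW hQW
  have hMQ : (A - E * Qᵀ) * Q = Q * diagonal d := by
    rw [Matrix.sub_mul, Matrix.mul_assoc, hQ', Matrix.mul_one, ← hE, sub_sub_cancel]
  -- The nonsymmetric correction vanishes on the complement of `Q`, so the compression is symmetric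
  -- and its eigenvalues control its quadratic form.
  have hWMW : Wᵀ * (A - E * Qᵀ) * W = Wᵀ * A * W := by
    rw [Matrix.mul_sub, Matrix.sub_mul, Matrix.mul_assoc Wᵀ (E * Qᵀ), Matrix.mul_assoc E, hQW,
      Matrix.mul_zero, Matrix.mul_zero, sub_zero]
  have hBherm : (Wᵀ * (A - E * Qᵀ) * W).IsHermitian := by
    rw [hWMW, IsHermitian, conjTranspose_eq_transpose_of_trivial]
    simp only [transpose_mul, transpose_transpose, hAt, Matrix.mul_assoc]
  have hB := hlead.quadraticForm_compl_le hcard hW hQW hMQ hBherm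
  rw [hWMW] at hB
  obtain ⟨P, s, hP1, hP2, hsanti, hds, hsd, hss⟩ := exists_antitone_diagonalization d
  have hPs : Q * P * diagonal s * (Q * P)ᵀ = Q * diagonal d * Qᵀ := by
    rw [hds]; simp only [transpose_mul, Matrix.mul_assoc]
  have hQPone : Q * P * (Q * P)ᵀ + W * Wᵀ = 1 := by
    rw [← hQone]
    congr 1
    calc Q * P * (Q * P)ᵀ = Q * (P * Pᵀ) * Qᵀ := by simp only [transpose_mul, Matrix.mul_assoc]
      _ = Q * Qᵀ := by rw [hP2, Matrix.mul_one]
  have hAH := norm_sub_blockDiagonal_le hAt hQ' hW hQW hQone hE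
  rw [← hPs] at hAH
  nth_rw 1 [hdecomp] at hAH
  rw [hL, hLp] at hAH
  change _ ≤ 2 * norm2 E at hAH
  have hLpform : ∀ i y, y ⬝ᵥ (diagonal e *ᵥ y) ≤ l i * (y ⬝ᵥ y) := fun i y =>
    dotProduct_diagonal_mulVec_le fun k _ => ((her k).trans hlt.le).trans (hlr i)
  have hls := abs_leading_diagonal_sub_le hcard' hVone hQPone hlanti hsanti hLpform
    (fun i y => by obtain ⟨j, hj⟩ := hss i; rw [hj]; exact hB j y) hAH
  have hE0 : 0 ≤ norm2 E := norm_nonneg E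
  have hgap1 : gap ≤ lamr - lamr1 := hgap ▸ min_le_left _ _
  have hgap2 : gap ≤ sep norm2Inf Vp L (Vp * Lp * Vpᵀ) := hgap ▸ min_le_right _ _
  have hgap0 : 0 ≤ gap := by linarith
  have hδ : 0 < lamr - lamr1 := sub_pos.2 hlt
  have hd_low : ∀ j, lamr1 + (lamr - lamr1 - 2 * norm2 E) ≤ d j := fun j => by
    obtain ⟨i, hi⟩ := hsd j
    linarith [hlr i, (abs_le.1 (hls i)).2]
  have hVpA : Vpᵀ * A = Lp * Vpᵀ := by
    rw [hdecomp, Matrix.mul_add]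
    simp only [← Matrix.mul_assoc]
    rw [hVpV, hVp', Matrix.zero_mul, Matrix.zero_mul, zero_add, Matrix.one_mul]
  have hsylv : Vpᵀ * Q * diagonal d - diagonal e * (Vpᵀ * Q) = -(Vpᵀ * E) := by
    rw [← hE, Matrix.mul_sub, ← Matrix.mul_assoc Vpᵀ A Q, hVpA, hLp, Matrix.mul_assoc (diagonal e),
      ← Matrix.mul_assoc Vpᵀ Q (diagonal d), neg_sub]
  have hsin := mul_l2_opNorm_le_sylvester (by linarith) hd_low her (Vpᵀ * Q)
  rw [hsylv, norm_neg] at hsin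
  have hVpn : ‖Vpᵀ‖ ≤ 1 := (l2_opNorm_transpose Vp).trans_le (l2_opNorm_le_one hVp')
  have hsin' := hsin.trans (l2_opNorm_mul_le_left hVpn E)
  change _ ≤ norm2 E at hsin'
  set x := ‖Vpᵀ * Q‖ with hx
  have hx0 : 0 ≤ x := norm_nonneg _
  -- Since `norm2 E` is at most a fifth of the eigengap, three fifths of it survive the shift by `2
  -- * norm2 E`.
  have hxle : x ≤ 5 / 3 * (norm2 E / (lamr - lamr1)) := by
    rw [← mul_div_assoc, le_div_iff₀ hδ]
    nlinarith
  have hratio : norm2 E / (lamr - lamr1) ≤ 1 / 5 := by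
    rw [div_le_iff₀ hδ]
    linarith
  have hratio0 : 0 ≤ norm2 E / (lamr - lamr1) := div_nonneg hE0 hδ.le
  have hmain := dist2Inf_le_sq_add hQ' hVone (by linarith : x < 1)
  have hsep := sep_sub_mul_norm2Inf_le hVp' hVpA hE hP1 hP2 hds (by linarith) hls
  rw [← hL] at hsep
  have hV0 := norm2Inf_nonneg V
  have hz0 := norm2Inf_nonneg (Vp * (Vpᵀ * Q))
  have hK0 : 0 ≤ normInf (Vp * Vpᵀ) * (norm2Inf E / gap) :=
    mul_nonneg (normInf_nonneg _) (div_nonneg (norm2Inf_nonneg _) hgap0)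
  have hz : norm2Inf (Vp * (Vpᵀ * Q)) ≤ 2 * (normInf (Vp * Vpᵀ) * (norm2Inf E / gap)) := by
    -- If `gap = 0`, division by it returns zero and the left side must vanish. It does: `norm2 E =
    -- 0`, which forces the sine `x` to be zero.
    obtain h0 | hpos := hgap0.eq_or_lt
    · have hx' : x ≤ 0 := by
        have : norm2 E = 0 := by linarith
        rw [this] at hxle
        simpa using hxle
      have := norm2Inf_mul_le Vp (Vpᵀ * Q)
      rw [← hx, le_antisymm hx' hx0, mul_zero] at this
      exact this.trans (mul_nonneg zero_le_two hK0)
    · rw [← mul_div_assoc, ← mul_div_assoc, le_div_iff₀ hpos]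
      have hKE := mul_nonneg (normInf_nonneg (Vp * Vpᵀ)) (norm2Inf_nonneg E)
      -- This yields the factor `5 / 3`, which is below the required `2`.
      have h35 : 3 / 5 * gap ≤ sep norm2Inf Vp L (Vp * Lp * Vpᵀ) - 2 * norm2 E := by linarith
      have := (mul_le_mul_of_nonneg_right h35 hz0).trans hsep
      linarith
  -- The argument gives `25 / 9` in place of `8`.
  have hsq : x ^ 2 ≤ 8 * (norm2 E / (lamr - lamr1)) ^ 2 := by
    have := pow_le_pow_left₀ hx0 hxle 2
    rw [mul_pow] at this
    exact this.trans (mul_le_mul_of_nonneg_right (by norm_num) (sq_nonneg _))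
  have hterm : 0 ≤ 2 * norm2 E / (lamr - lamr1) := div_nonneg (by linarith) hδ.le
  refine hmain.trans (add_le_add ?_ (hz.trans ?_))
  · rw [mul_comm 8, mul_assoc]
    exact mul_le_mul_of_nonneg_left hsq hV0
  -- The last factor of the bound is only slack: it is at least one.
  · rw [← mul_assoc]
    exact le_mul_of_one_le_right (by rw [mul_assoc]; exact mul_nonneg zero_le_two hK0)
      (le_add_of_nonneg_right hterm)

end
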